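/- Let $\mathbb{S}^2\subset\mathbb{R}^3$ be the unit sphere with normalized surface measure $\sigma$. For $w\in\mathbb{S}^2$ and $t\in\mathbb{R}$ let $C(w,t)=\{x\in\mathbb{S}^2 : \langle w,x\rangle\ge t\}$, and for a finite nonempty set $P\subset\mathbb{S}^2$ put $$\mathcal{D}(P;w,t)=\left|\frac{\#(P\cap C(w,t))}{\#P}-\sigma(C(w,t))\right|,\qquad \mathcal{D}(P)=\sup_{w\in\mathbb{S}^2}\ \sup_{-1\le t\le 1}\mathcal{D}(P;w,t)$$ (the spherical cap discrepancy of $P$). Let $I^2=[0,1)\times(0,1)$ and let $L:I^2\to\mathbb{S}^2$ be the Lambert map $$L(x,y)=\big(2\sqrt{y-y^2}\cos(2\pi x),\ 2\sqrt{y-y^2}\sin(2\pi x),\ 1-2y\big).$$ For an integer $K\ge 1$ let $$P^{\mathbb{1}}(K)=\Big(\tfrac1K\mathbb{Z}^2+\tfrac1{2K}(1,1)\Big)\cap I^2,\qquad N=\#P^{\mathbb{1}}(K).$$ Then, for every integer $K\ge 1$, $N=K^2$, the image $L(P^{\mathbb{1}}(K))$ also consists of $K^2$ points, and $$\frac14\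 \le\ \sqrt{N}\cdot\mathcal{D}\big(L(P^{\mathbb{1}}(K))\big)\ \le\ \sqrt{18}.$$ Moreover, the value $\frac14$ is attained in the limit by caps centred at the north pole $n=(0,0,1)$: for every integer $K\ge 1$, $$\lim_{t\downarrow\frac{2K-1}{2K}}\ \sqrt{N}\cdot\mathcal{D}\big(L(P^{\mathbb{1}}(K));n,t\big)=\frac14 .$$ -/

import Mathlib

open Filter Topology MeasureTheory

noncomputable section

/-- Three-dimensional Euclidean space with its standard inner product. -/
abbrev E3 : Type := EuclideanSpace ℝ (Fin 3)

/-- The unit two-sphere `𝕊²`, the set of unit vectors of `ℝ³`. -/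
abbrev S2 : Type := Metric.sphere (0 : E3) 1

/-- The normalized surface measure of the unit sphere: the surface measure induced by Lebesgue
measure on `ℝ³`, divided by its total mass. -/
def sphereMeasure : Measure S2 :=
  ((volume : Measure E3).toSphere Set.univ)⁻¹ • (volume : Measure E3).toSphere

/-- The (closed) spherical cap with center `w` and height `t`. -/
def sphericalCap (w : S2) (t : ℝ) : Set S2 :=
  {x | t ≤ inner ℝ (w : E3) (x : E3)}

/-- The local discrepancy of a finite set `P ⊆ 𝕊²` at the cap `C(w, t)`: the distance between the
proportion of points of `P` that lie in the cap and the normalized area of the cap. -/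
def capDiscrepancyAt (P : Set S2) (w : S2) (t : ℝ) : ℝ :=
  |((P ∩ sphericalCap w t).ncard : ℝ) / (P.ncard : ℝ) - sphereMeasure.real (sphericalCap w t)|

/-- The spherical cap discrepancy of a finite set `P ⊆ 𝕊²`. All the quantities under the
suprema lie in `[0, 1]`, so these are suprema of nonempty bounded sets of reals. -/
def capDiscrepancy (P : Set S2) : ℝ :=
  ⨆ w : S2, ⨆ t : Set.Icc (-1 : ℝ) 1, capDiscrepancyAt P w t

/-- The square `I² = [0,1) × (0,1)`, the unit square with three boundary sides removed. -/
def unitSquare : Set (ℝ × ℝ) := Set.Ico 0 1 ×ˢ Set.Ioo 0 1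

/-- The coordinate expression of the Lambert map. -/
def lambertVec (x y : ℝ) : E3 :=
  !₂[2 * √(y - y ^ 2) * Real.cos (2 * Real.pi * x),
     2 * √(y - y ^ 2) * Real.sin (2 * Real.pi * x),
     1 - 2 * y]

theorem lambertVec_mem_sphere {x y : ℝ} (h0 : 0 ≤ y) (h1 : y ≤ 1) :
    lambertVec x y ∈ Metric.sphere (0 : E3) 1 := by
  have hy : 0 ≤ y - y ^ 2 := by nlinarith
  have hs := Real.sq_sqrt hy
  have hc := Real.sin_sq_add_cos_sq (2 * Real.pi * x)
  rw [mem_sphere_zero_iff_norm, EuclideanSpace.norm_eq, Real.sqrt_eq_one]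
  simp [lambertVec, Fin.sum_univ_three]
  linear_combination 4 * (√(y - y ^ 2)) ^ 2 * hc + 4 * hs

/-- The Lambert map `L : I² → 𝕊²`. -/
def lambert (p : unitSquare) : S2 :=
  ⟨lambertVec p.1.1 p.1.2, lambertVec_mem_sphere p.2.2.1.le p.2.2.2.le⟩

/-- The shifted standard lattice points `((1/K) ℤ² + (1/(2K)) (1,1)) ∩ I²`. -/
def standardPoints (K : ℕ) : Set (ℝ × ℝ) :=
  {p | ∃ a b : ℤ, p = ((a : ℝ) / K + 1 / (2 * K), (b : ℝ) / K + 1 / (2 * K))} ∩ unitSquare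

/-- The image `L(P)` under the Lambert map of a subset `P` of `I²`. -/
def lambertImage (P : Set (ℝ × ℝ)) : Set S2 :=
  {q | ∃ p : unitSquare, (p : ℝ × ℝ) ∈ P ∧ lambert p = q}

/-- The north pole `(0, 0, 1)` of the sphere. -/
def northPole : S2 :=
  ⟨!₂[0, 0, 1], by
    rw [mem_sphere_zero_iff_norm, EuclideanSpace.norm_eq, Real.sqrt_eq_one]
    simp [Fin.sum_univ_three]⟩

end

/-! The Lambert map preserves area (`sphereMeasure_apply`), so everything can be measured in the
unit square. The preimage of a cap is studied column by column: on the meridian with parameter `x`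
it is the set of heights where a multiple of a half circle plus an affine function is at least `t`.

Upper bound. The half circle is concave, so each column section is an interval or the complement of
one in `(0, 1)`. Hence the number of midpoints in it differs from `K` times its length by at most 1
(`abs_card_meridianSection_sub_le`), which costs at most `K` over all columns. The section length is
a monotone function, with values in `[0, 1]`, of the horizontal component of `w` along the meridian.
That component is a sinusoid in `x`, with at most three monotone pieces on one period, so the length
has variation at most 3 (`eVariationOn_comp_cos_le`). Summing it over the `K` midpoints instead of
integrating therefore costs at most 3, and this is multiplied by `K`
(`abs_sum_midpointNode_sub_integral_le`). The counting error is at most `4 * K` out of `K ^ 2`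
points, giving discrepancy at most `4 / K`, and `4 ≤ √18`.

Lower bound. Small caps at the north pole contain no point, so their discrepancy is their area `(1 -
t) / 2`, which tends to `1 / (4 * K)` at the stated threshold. -/

/-! ### Injectivity of the Lambert map and pullback to the square. -/

theorem eq_of_cos_two_pi_eq_of_sin_two_pi_eq {x x' : ℝ} (hx : x ∈ Set.Ico (0 : ℝ) 1)
    (hx' : x' ∈ Set.Ico (0 : ℝ) 1)
    (hc : Real.cos (2 * Real.pi * x) = Real.cos (2 * Real.pi * x'))
    (hs : Real.sin (2 * Real.pi * x) = Real.sin (2 * Real.pi * x')) : x = x' := by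
  obtain ⟨k, hk⟩ := Real.Angle.angle_eq_iff_two_pi_dvd_sub.1 (Real.Angle.cos_sin_inj hc hs)
  have h : x - x' = k := by
    have h2 : (2 * Real.pi) ≠ 0 := by positivity
    exact mul_left_cancel₀ h2 (by linarith)
  have h1 : (k : ℝ) < 1 := by linarith [hx.2, hx'.1]
  have h2 : (-1 : ℝ) < k := by linarith [hx.1, hx'.2]
  have h3 : k < 1 := by exact_mod_cast h1
  have h4 : -1 < k := by exact_mod_cast h2
  have : k = 0 := by omega
  rw [this] at h
  simpa [sub_eq_zero] using h

theorem sqrt_sub_sq_pos {y : ℝ} (hy : y ∈ Set.Ioo (0 : ℝ) 1) : 0 < √(y - y ^ 2) :=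
  Real.sqrt_pos.2 (by nlinarith [hy.1, hy.2])

theorem lambertVec_injOn {p q : ℝ × ℝ} (hp : p ∈ unitSquare) (hq : q ∈ unitSquare)
    (h : lambertVec p.1 p.2 = lambertVec q.1 q.2) : p = q := by
  have h0 := congrArg (fun v : E3 => v 0) h
  have h1 := congrArg (fun v : E3 => v 1) h
  have h2 := congrArg (fun v : E3 => v 2) h
  simp only [lambertVec, PiLp.toLp_apply, Matrix.cons_val] at h0 h1 h2
  have hy : p.2 = q.2 := by linarith
  rw [hy] at h0 h1
  have hpos : 2 * √(q.2 - q.2 ^ 2) ≠ 0 := (mul_pos two_pos (sqrt_sub_sq_pos hq.2)).ne'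
  exact Prod.ext (eq_of_cos_two_pi_eq_of_sin_two_pi_eq hp.1 hq.1
    (mul_left_cancel₀ hpos h0) (mul_left_cancel₀ hpos h1)) hy

theorem lambert_injective : Function.Injective lambert := fun p q h =>
  Subtype.ext (lambertVec_injOn p.2 q.2 (congrArg Subtype.val h))

theorem measurableSet_unitSquare : MeasurableSet unitSquare :=
  measurableSet_Ico.prod measurableSet_Ioo

theorem continuous_lambertVec : Continuous fun p : ℝ × ℝ => lambertVec p.1 p.2 := by
  unfold lambertVec
  refine (PiLp.continuous_toLp 2 _).comp (continuous_pi fun i => ?_)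
  fin_cases i <;> simp <;> fun_prop

theorem measurable_lambert : Measurable lambert :=
  (continuous_lambertVec.measurable.comp measurable_subtype_coe).subtype_mk

/-- The part of the unit square that the Lambert map sends into `A`. -/
def lambertPreimage (A : Set S2) : Set (ℝ × ℝ) := Subtype.val '' (lambert ⁻¹' A)

theorem measurableSet_lambertPreimage {A : Set S2} (hA : MeasurableSet A) :
    MeasurableSet (lambertPreimage A) :=
  (MeasurableEmbedding.subtype_coe measurableSet_unitSquare).measurableSet_image.2
    (measurable_lambert hA)

theorem lambertPreimage_subset (A : Set S2) : lambertPreimage A ⊆ unitSquare := by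
  rintro _ ⟨p, -, rfl⟩; exact p.2

theorem volume_unitSquare : volume unitSquare = 1 := by
  rw [unitSquare, Measure.volume_eq_prod, Measure.prod_prod]; simp

theorem volume_lambertPreimage_add_compl {A : Set S2} (hA : MeasurableSet A) :
    volume (lambertPreimage A) + volume (lambertPreimage Aᶜ) = 1 := by
  have hd : Disjoint (lambertPreimage A) (lambertPreimage Aᶜ) :=
    Set.disjoint_image_of_injective Subtype.val_injective
      (disjoint_compl_right.preimage lambert)
  rw [← measure_union hd (measurableSet_lambertPreimage hA.compl), lambertPreimage,
    lambertPreimage, ← Set.image_union, ← Set.preimage_union, Set.union_compl_self,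
    Set.preimage_univ, Set.image_univ, Subtype.range_coe, volume_unitSquare]

/-! ### Area preservation, through volumes of cones in `ℝ³`. -/

noncomputable section

/-- The map `(ρ, x, y) ↦ ρ • L(x, y)` in coordinates. -/
def conicalMap (v : Fin 3 → ℝ) : Fin 3 → ℝ :=
  ![v 0 * (2 * √(v 2 - v 2 ^ 2) * Real.cos (2 * Real.pi * v 1)),
    v 0 * (2 * √(v 2 - v 2 ^ 2) * Real.sin (2 * Real.pi * v 1)),
    v 0 * (1 - 2 * v 2)]

theorem conicalMap_eq (v : Fin 3 → ℝ) :
    WithLp.toLp 2 (conicalMap v) = v 0 • lambertVec (v 1) (v 2) := by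
  ext i
  fin_cases i <;> simp [conicalMap, lambertVec]

/-- The Jacobian matrix of `conicalMap`. -/
def conicalJacobian (v : Fin 3 → ℝ) : Matrix (Fin 3) (Fin 3) ℝ :=
  let g := √(v 2 - v 2 ^ 2)
  let c := Real.cos (2 * Real.pi * v 1)
  let s := Real.sin (2 * Real.pi * v 1)
  !![2 * g * c, -(v 0 * (2 * g * (2 * Real.pi * s))), v 0 * ((1 - 2 * v 2) / g * c);
     2 * g * s, v 0 * (2 * g * (2 * Real.pi * c)), v 0 * ((1 - 2 * v 2) / g * s);
     1 - 2 * v 2, 0, v 0 * (-2)]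

end

/-- Infinitesimal area preservation: the determinant depends on the radius only, since the factors
`√(y - y ^ 2)` cancel. -/
theorem det_conicalJacobian {v : Fin 3 → ℝ} (hv : v 2 ∈ Set.Ioo (0 : ℝ) 1) :
    (conicalJacobian v).det = -(4 * Real.pi * v 0 ^ 2) := by
  have hg := (sqrt_sub_sq_pos hv).ne'
  have hg2 : √(v 2 - v 2 ^ 2) ^ 2 = v 2 - v 2 ^ 2 :=
    Real.sq_sqrt (by nlinarith [hv.1, hv.2])
  have hcs := Real.sin_sq_add_cos_sq (2 * Real.pi * v 1)
  simp only [conicalJacobian]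
  generalize √(v 2 - v 2 ^ 2) = g at *
  generalize Real.cos (2 * Real.pi * v 1) = c at *
  generalize Real.sin (2 * Real.pi * v 1) = s at *
  rw [Matrix.det_fin_three]
  simp
  field_simp
  have hs : s ^ 2 = 1 - c ^ 2 := by linarith
  ring_nf
  simp only [hs, hg2]
  ring_nf

theorem hasFDerivAt_conicalMap {v : Fin 3 → ℝ} (hv : v 2 ∈ Set.Ioo (0 : ℝ) 1) :
    HasFDerivAt conicalMap (LinearMap.toContinuousLinearMap (Matrix.toLin' (conicalJacobian v)))
      v := by
  have hpos : v 2 - v 2 ^ 2 ≠ 0 := by nlinarith [hv.1, hv.2]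
  have hg := (sqrt_sub_sq_pos hv).ne'
  have p (i : Fin 3) : HasFDerivAt (fun w : Fin 3 → ℝ => w i)
      (ContinuousLinearMap.proj (R := ℝ) (φ := fun _ : Fin 3 => ℝ) i) v :=
    hasFDerivAt_apply i v
  have hsq := ((p 2).sub ((p 2).pow 2)).sqrt hpos
  have hc := ((p 1).const_mul (2 * Real.pi)).cos
  have hs := ((p 1).const_mul (2 * Real.pi)).sin
  have h0 := (p 0).mul ((hsq.const_mul 2).mul hc)
  have h1 := (p 0).mul ((hsq.const_mul 2).mul hs)
  have h2 := (p 0).mul (((p 2).const_mul 2).const_sub 1)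
  rw [hasFDerivAt_pi']
  intro i
  fin_cases i
  · refine h0.congr_fderiv ?_
    ext w
    simp [conicalJacobian, dotProduct, Fin.sum_univ_three]
    field_simp
    ring
  · refine h1.congr_fderiv ?_
    ext w
    simp [conicalJacobian, dotProduct, Fin.sum_univ_three]
    field_simp
    ring
  · refine h2.congr_fderiv ?_
    ext w
    simp [conicalJacobian, dotProduct, Fin.sum_univ_three]
    ring

/-- The measurable equivalence splitting off the first of three real coordinates. -/
def splitFirst : (Fin 3 → ℝ) ≃ᵐ ℝ × (ℝ × ℝ) :=
  (MeasurableEquiv.piFinSuccAbove (fun _ : Fin 3 => ℝ) 0).trans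
    ((MeasurableEquiv.refl ℝ).prodCongr (MeasurableEquiv.finTwoArrow (α := ℝ)))

theorem splitFirst_apply (v : Fin 3 → ℝ) : splitFirst v = (v 0, (v 1, v 2)) := rfl

theorem measurePreserving_splitFirst : MeasurePreserving splitFirst volume volume :=
  ((MeasurePreserving.id volume).prod (volume_preserving_finTwoArrow ℝ)).comp
    (volume_preserving_piFinSuccAbove (fun _ : Fin 3 => ℝ) 0)

/-- The norm recovers the radius, because Lambert vectors have norm 1; injectivity on the square
then recovers the rest. -/
theorem injOn_conicalMap :
    Set.InjOn conicalMap (splitFirst ⁻¹' (Set.Ioo 0 1 ×ˢ unitSquare)) := by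
  intro v hv w hw h
  have h' : v 0 • lambertVec (v 1) (v 2) = w 0 • lambertVec (w 1) (w 2) := by
    rw [← conicalMap_eq, ← conicalMap_eq, h]
  have hv' : 0 < v 0 := hv.1.1
  have hw' : 0 < w 0 := hw.1.1
  have nv : ‖lambertVec (v 1) (v 2)‖ = 1 :=
    mem_sphere_zero_iff_norm.1 (lambertVec_mem_sphere hv.2.2.1.le hv.2.2.2.le)
  have nw : ‖lambertVec (w 1) (w 2)‖ = 1 :=
    mem_sphere_zero_iff_norm.1 (lambertVec_mem_sphere hw.2.2.1.le hw.2.2.2.le)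
  have h0 : v 0 = w 0 := by
    have := congrArg norm h'
    rwa [norm_smul, norm_smul, nv, nw, mul_one, mul_one, Real.norm_of_nonneg hv'.le,
      Real.norm_of_nonneg hw'.le] at this
  rw [h0] at h'
  have h12 : ((v 1, v 2) : ℝ × ℝ) = (w 1, w 2) :=
    lambertVec_injOn hv.2 hw.2 (smul_right_injective _ hw'.ne' h')
  apply splitFirst.injective
  rw [splitFirst_apply, splitFirst_apply, h0, h12]

theorem lintegral_four_pi_sq :
    ∫⁻ r in Set.Ioo (0 : ℝ) 1, ENNReal.ofReal (4 * Real.pi * r ^ 2) =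
      ENNReal.ofReal (4 * Real.pi / 3) := by
  rw [← ofReal_integral_eq_lintegral_ofReal]
  · rw [← integral_Ioc_eq_integral_Ioo, ← intervalIntegral.integral_of_le zero_le_one]
    congr 1
    rw [intervalIntegral.integral_const_mul, integral_pow]
    norm_num
    ring
  · exact ((by fun_prop : Continuous fun r : ℝ => 4 * Real.pi * r ^ 2).integrableOn_Icc).mono_set
      Set.Ioo_subset_Icc_self
  · exact ae_of_all _ fun r => by positivity

/-- Change of variables followed by Fubini: the Jacobian depends on the radius alone, so the
integral factors. -/
theorem volume_image_conicalMap {B : Set (ℝ × ℝ)} (hB : MeasurableSet B) (hBs : B ⊆ unitSquare) :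
    volume (conicalMap '' (splitFirst ⁻¹' (Set.Ioo 0 1 ×ˢ B))) =
      ENNReal.ofReal (4 * Real.pi / 3) * volume B := by
  have hms : MeasurableSet (Set.Ioo (0 : ℝ) 1 ×ˢ B) := measurableSet_Ioo.prod hB
  have hsub : splitFirst ⁻¹' (Set.Ioo 0 1 ×ˢ B) ⊆ splitFirst ⁻¹' (Set.Ioo 0 1 ×ˢ unitSquare) :=
    Set.preimage_mono (Set.prod_mono_right hBs)
  rw [← lintegral_abs_det_fderiv_eq_addHaar_image volume (splitFirst.measurable hms)
    (fun v hv => (hasFDerivAt_conicalMap (hBs hv.2).2).hasFDerivWithinAt)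
    (injOn_conicalMap.mono hsub)]
  have hcongr : ∫⁻ v in splitFirst ⁻¹' (Set.Ioo 0 1 ×ˢ B), ENNReal.ofReal
      |(LinearMap.toContinuousLinearMap (Matrix.toLin' (conicalJacobian v))).det| =
      ∫⁻ v in splitFirst ⁻¹' (Set.Ioo 0 1 ×ˢ B),
        (fun q : ℝ × ℝ × ℝ => ENNReal.ofReal (4 * Real.pi * q.1 ^ 2)) (splitFirst v) := by
    refine setLIntegral_congr_fun (splitFirst.measurable hms) fun v hv => ?_
    have : (LinearMap.toContinuousLinearMap (Matrix.toLin' (conicalJacobian v))).det =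
        (conicalJacobian v).det := by
      rw [ContinuousLinearMap.det, LinearMap.coe_toContinuousLinearMap, LinearMap.det_toLin']
    simp only [this, det_conicalJacobian (hBs hv.2).2, abs_neg, splitFirst_apply]
    rw [abs_of_nonneg (by positivity)]
  have hmap := measurePreserving_splitFirst.setLIntegral_comp_preimage_emb
    splitFirst.measurableEmbedding
    (fun q : ℝ × ℝ × ℝ => ENNReal.ofReal (4 * Real.pi * q.1 ^ 2)) (Set.Ioo 0 1 ×ˢ B)
  rw [hcongr, hmap, Measure.volume_eq_prod, ← Measure.prod_restrict,
    lintegral_prod _ (by fun_prop)]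
  simp only [lintegral_const, MeasurableSet.univ, Measure.restrict_apply, Set.univ_inter]
  rw [lintegral_mul_const _ (by fun_prop), lintegral_four_pi_sq]

open scoped Pointwise in
-- `toSphere` of `A` is three times the volume of the cone over `A`, which contains the image of
-- `conicalMap`. One inequality suffices, so the poles missed by the Lambert map need no treatment.
theorem le_toSphere_apply {A : Set S2} (hA : MeasurableSet A) :
    ENNReal.ofReal (4 * Real.pi) * volume (lambertPreimage A) ≤
      (volume : Measure E3).toSphere A := by
  rw [Measure.toSphere_apply' _ hA]
  have h := volume_image_conicalMap (measurableSet_lambertPreimage hA) (lambertPreimage_subset A)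
  have hle : volume (conicalMap '' (splitFirst ⁻¹' (Set.Ioo 0 1 ×ˢ lambertPreimage A))) ≤
      volume (Set.Ioo (0 : ℝ) 1 • ((↑) '' A : Set E3)) := by
    rw [← (PiLp.volume_preserving_toLp (Fin 3)).measure_preimage_emb
      (MeasurableEquiv.toLp 2 (Fin 3 → ℝ)).measurableEmbedding]
    refine measure_mono ?_
    rintro _ ⟨v, hv, rfl⟩
    obtain ⟨p, hpA, hp⟩ := hv.2
    rw [Set.mem_preimage, conicalMap_eq]
    refine Set.smul_mem_smul hv.1 ⟨lambert p, hpA, ?_⟩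
    simp only [lambert, hp, splitFirst_apply]
  rw [h] at hle
  have h3 : ENNReal.ofReal (4 * Real.pi) = 3 * ENNReal.ofReal (4 * Real.pi / 3) := by
    rw [show (3 : ENNReal) = ENNReal.ofReal 3 by simp, ← ENNReal.ofReal_mul (by norm_num)]
    congr 1
    ring
  simp only [finrank_euclideanSpace, Fintype.card_fin, Nat.cast_ofNat]
  rw [h3, mul_assoc]
  gcongr

theorem toSphere_univ_eq :
    (volume : Measure E3).toSphere Set.univ = ENNReal.ofReal (4 * Real.pi) := by
  rw [Measure.toSphere_apply_univ, EuclideanSpace.volume_ball_fin_three]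
  simp only [finrank_euclideanSpace, Fintype.card_fin, Nat.cast_ofNat, ENNReal.ofReal_one, one_pow,
    one_mul]
  rw [show (3 : ENNReal) = ENNReal.ofReal 3 by simp, ← ENNReal.ofReal_mul (by norm_num)]
  congr 1
  ring

/-- The Lambert map is area preserving. -/
theorem sphereMeasure_apply {A : Set S2} (hA : MeasurableSet A) :
    sphereMeasure A = volume (lambertPreimage A) := by
  have hc0 : ENNReal.ofReal (4 * Real.pi) ≠ 0 := by
    simp [Real.pi_pos]
  have hct : ENNReal.ofReal (4 * Real.pi) ≠ ⊤ := ENNReal.ofReal_ne_top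
  have key : (volume : Measure E3).toSphere A =
      ENNReal.ofReal (4 * Real.pi) * volume (lambertPreimage A) := by
    -- The lower bounds for `A` and `Aᶜ` add up to the finite total mass `4π`, so neither can be
    -- strict.
    refine le_antisymm ?_ (le_toSphere_apply hA)
    have hsum := measure_add_measure_compl (μ := (volume : Measure E3).toSphere) hA
    rw [toSphere_univ_eq] at hsum
    have h2 : ENNReal.ofReal (4 * Real.pi) * volume (lambertPreimage A) +
        ENNReal.ofReal (4 * Real.pi) * volume (lambertPreimage Aᶜ) =
        ENNReal.ofReal (4 * Real.pi) := by
      rw [← mul_add, volume_lambertPreimage_add_compl hA, mul_one]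
    have hfin : ENNReal.ofReal (4 * Real.pi) * volume (lambertPreimage Aᶜ) ≠ ⊤ :=
      ne_top_of_le_ne_top hct (le_add_self.trans_eq h2)
    refine (ENNReal.add_le_add_iff_right hfin).1 ?_
    exact (add_le_add_right (le_toSphere_apply hA.compl) _).trans_eq (hsum.trans h2.symm)
  rw [sphereMeasure, Measure.smul_apply, toSphere_univ_eq, key, smul_eq_mul, ← mul_assoc,
    ENNReal.inv_mul_cancel hc0 hct, one_mul]

/-! ### Midpoint counts in intervals and the midpoint rule. -/

/-- The `j`-th midpoint of the partition of `[0, 1]` into `K` equal intervals. -/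
noncomputable def midpointNode (K j : ℕ) : ℝ := (j : ℝ) / K + 1 / (2 * K)

theorem midpointNode_eq {K : ℕ} (hK : 1 ≤ K) (j : ℕ) : midpointNode K j = (j + 1 / 2) / K := by
  have : (K : ℝ) ≠ 0 := by positivity
  rw [midpointNode]
  field_simp

theorem midpointNode_mem {K j : ℕ} (hj : j < K) : midpointNode K j ∈ Set.Ioo (0 : ℝ) 1 := by
  have hK : (0 : ℝ) < K := by exact_mod_cast (by omega : 0 < K)
  have hj' : (j : ℝ) + 1 ≤ K := by exact_mod_cast hj
  rw [midpointNode_eq (by omega)]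
  refine ⟨by positivity, ?_⟩
  rw [div_lt_one hK]
  linarith

open Classical in
-- Up to endpoints `Y` is an interval from `α` to `β`, and the count is that of integers in an
-- interval of length `K * (β - α)`, closed for the upper estimate and open for the lower one.
theorem abs_card_midpointNode_sub_le_of_ordConnected {K : ℕ} (hK : 1 ≤ K) {Y : Set ℝ}
    (hY : Y.OrdConnected) (hYs : Y ⊆ Set.Ioo 0 1) :
    |(((Finset.range K).filter fun j => midpointNode K j ∈ Y).card : ℝ) -
      K * volume.real Y| ≤ 1 := by
  rcases Y.eq_empty_or_nonempty with rfl | hne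
  · simp
  have hK0 : (0 : ℝ) < K := by exact_mod_cast hK
  have hbb : BddBelow Y := ⟨0, fun y hy => (hYs hy).1.le⟩
  have hba : BddAbove Y := ⟨1, fun y hy => (hYs hy).2.le⟩
  set α := sInf Y
  set β := sSup Y
  have hα : 0 ≤ α := le_csInf hne fun y hy => (hYs hy).1.le
  have hβ : β ≤ 1 := csSup_le hne fun y hy => (hYs hy).2.le
  have hαβ : α ≤ β := by
    obtain ⟨y, hy⟩ := hne
    exact (csInf_le hbb hy).trans (le_csSup hba hy)
  have hIcc : Y ⊆ Set.Icc α β := fun y hy => ⟨csInf_le hbb hy, le_csSup hba hy⟩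
  have hIoo : Set.Ioo α β ⊆ Y := by
    rintro y ⟨h1, h2⟩
    obtain ⟨u, hu, huy⟩ := exists_lt_of_csInf_lt hne h1
    obtain ⟨v, hv, hyv⟩ := exists_lt_of_lt_csSup hne h2
    exact hY.out hu hv ⟨huy.le, hyv.le⟩
  have hvol : volume.real Y = β - α := by
    apply le_antisymm
    · rw [← max_eq_left (sub_nonneg.2 hαβ), ← Real.volume_real_Icc]
      exact measureReal_mono hIcc (by rw [Real.volume_Icc]; exact ENNReal.ofReal_ne_top)
    · rw [← max_eq_left (sub_nonneg.2 hαβ), ← Real.volume_real_Ioo]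
      exact measureReal_mono hIoo (ne_top_of_le_ne_top (by rw [Real.volume_Icc]; exact ENNReal.ofReal_ne_top)
        (measure_mono hIcc))
  set S := (Finset.range K).filter fun j => midpointNode K j ∈ Y
  have hS : (S.map Nat.castEmbedding : Finset ℤ).card = S.card := Finset.card_map _
  have hup : (S.card : ℝ) ≤ K * (β - α) + 1 := by
    have hsub : (S.map Nat.castEmbedding : Finset ℤ) ⊆
        Finset.Icc ⌈K * α - 1 / 2⌉ ⌊K * β - 1 / 2⌋ := by
      intro z hz
      obtain ⟨j, hj, rfl⟩ := Finset.mem_map.1 hz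
      have hjY := hIcc (Finset.mem_filter.1 hj).2
      rw [midpointNode_eq hK] at hjY
      have h1 := (le_div_iff₀ hK0).1 hjY.1
      have h2 := (div_le_iff₀ hK0).1 hjY.2
      simp only [Nat.castEmbedding_apply, Finset.mem_Icc, Int.ceil_le, Int.le_floor,
        Int.cast_natCast]
      constructor <;> linarith
    have hcard := Finset.card_le_card hsub
    rw [hS, Int.card_Icc] at hcard
    have hnn : (0 : ℝ) ≤ K * (β - α) := mul_nonneg hK0.le (sub_nonneg.2 hαβ)
    -- `Int.card_Icc` is a truncated difference; a positive count is needed to remove the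
    -- truncation.
    rcases Nat.eq_zero_or_pos S.card with h0 | h0
    · rw [h0]; push_cast; linarith
    · have hz : (S.card : ℤ) ≤ ⌊K * β - 1 / 2⌋ + 1 - ⌈K * α - 1 / 2⌉ := by omega
      have hr : (S.card : ℝ) ≤ ⌊K * β - 1 / 2⌋ + 1 - ⌈K * α - 1 / 2⌉ := by exact_mod_cast hz
      linarith [Int.floor_le (K * β - 1 / 2), Int.le_ceil (K * α - 1 / 2)]
  have hlow : K * (β - α) - 1 ≤ (S.card : ℝ) := by
    have hsub : Finset.Ioo ⌊K * α - 1 / 2⌋ ⌈K * β - 1 / 2⌉ ⊆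
        (S.map Nat.castEmbedding : Finset ℤ) := by
      intro z hz
      rw [Finset.mem_Ioo, Int.floor_lt, Int.lt_ceil] at hz
      have h1 : (-1 : ℝ) < z := by nlinarith [hz.1]
      have h2 : (z : ℝ) < K := by nlinarith [hz.2]
      have h1' : -1 < z := by exact_mod_cast h1
      have h2' : z < K := by exact_mod_cast h2
      obtain ⟨j, rfl⟩ := Int.eq_ofNat_of_zero_le (by omega : 0 ≤ z)
      refine Finset.mem_map.2 ⟨j, Finset.mem_filter.2 ⟨Finset.mem_range.2 (by omega), ?_⟩, rfl⟩
      rw [midpointNode_eq hK]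
      simp only [Int.cast_natCast] at hz
      exact hIoo ⟨(lt_div_iff₀ hK0).2 (by linarith), (div_lt_iff₀ hK0).2 (by linarith)⟩
    have hcard := Finset.card_le_card hsub
    rw [hS, Int.card_Ioo] at hcard
    have hz : ⌈K * β - 1 / 2⌉ - ⌊K * α - 1 / 2⌋ - 1 ≤ (S.card : ℤ) := by omega
    have hr : (⌈K * β - 1 / 2⌉ : ℝ) - ⌊K * α - 1 / 2⌋ - 1 ≤ S.card := by exact_mod_cast hz
    linarith [Int.floor_le (K * α - 1 / 2), Int.le_ceil (K * β - 1 / 2)]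
  rw [hvol, abs_le]
  constructor <;> linarith

open Classical in
-- All `K` midpoints lie in `(0, 1)`, so passing to the complement only changes the sign of the
-- error.
theorem abs_card_midpointNode_sub_le_of_ordConnected_diff {K : ℕ} (hK : 1 ≤ K) {Y : Set ℝ}
    (hY : (Set.Ioo 0 1 \ Y).OrdConnected) (hYs : Y ⊆ Set.Ioo 0 1) (hm : MeasurableSet Y) :
    |(((Finset.range K).filter fun j => midpointNode K j ∈ Y).card : ℝ) -
      K * volume.real Y| ≤ 1 := by
  have h := abs_card_midpointNode_sub_le_of_ordConnected hK hY Set.sdiff_subset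
  have hvol : volume.real (Set.Ioo 0 1 \ Y) = 1 - volume.real Y := by
    rw [measureReal_sdiff hYs hm (by rw [Real.volume_Ioo]; exact ENNReal.ofReal_ne_top)]
    simp
  have hcard : (((Finset.range K).filter fun j => midpointNode K j ∈ Set.Ioo 0 1 \ Y).card : ℝ) =
      K - ((Finset.range K).filter fun j => midpointNode K j ∈ Y).card := by
    have h1 := Finset.card_filter_add_card_filter_not (s := Finset.range K)
      (fun j => midpointNode K j ∈ Y)
    have h2 : (Finset.range K).filter (fun j => midpointNode K j ∈ Set.Ioo 0 1 \ Y) =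
        (Finset.range K).filter fun j => ¬ midpointNode K j ∈ Y :=
      Finset.filter_congr fun j hj => by
        simp only [Set.mem_sdiff, midpointNode_mem (Finset.mem_range.1 hj), true_and]
    rw [h2, eq_sub_iff_add_eq]
    rw [Finset.card_range] at h1
    exact_mod_cast (add_comm _ _).trans h1
  rw [hvol] at h
  have h' : |((K : ℝ) - ((Finset.range K).filter fun j => midpointNode K j ∈ Y).card) -
      K * (1 - volume.real Y)| ≤ 1 := by
    rw [← hcard]
    convert h
  rw [← abs_neg]
  convert h' using 2
  ring

/-- On each cell, `K` times the integral is the mean of `f`, which differs from the value at the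
node by at most the variation there; variations of adjacent cells add up. -/
theorem abs_sum_midpointNode_sub_integral_le {K : ℕ} (hK : 1 ≤ K) {f : ℝ → ℝ} {V : ℝ}
    (hV : 0 ≤ V) (hf : eVariationOn f (Set.Icc 0 1) ≤ ENNReal.ofReal V)
    (hint : IntervalIntegrable f volume 0 1) :
    |∑ i ∈ Finset.range K, f (midpointNode K i) - K * ∫ x in (0 : ℝ)..1, f x| ≤ V := by
  have hK0 : (0 : ℝ) < K := by exact_mod_cast hK
  set I : ℕ → ℝ := fun i => (i : ℝ) / K with hI
  have hmono : Monotone I := fun i j hij => by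
    simp only [hI]
    gcongr
  have hI0 : I 0 = 0 := by simp [hI]
  have hIK : I K = 1 := by simp [hI, hK0.ne']
  have hlen (i : ℕ) : I (i + 1) - I i = 1 / K := by
    simp only [hI]; push_cast; ring
  have hsubIcc {i : ℕ} (hi : i < K) : Set.Icc (I i) (I (i + 1)) ⊆ Set.Icc 0 1 := by
    rw [← hI0, ← hIK]
    exact Set.Icc_subset_Icc (hmono (Nat.zero_le _)) (hmono hi)
  have hsum := eVariationOn.sum' f hmono (n := K)
  rw [hI0, hIK] at hsum
  have hfin {i : ℕ} (hi : i < K) : eVariationOn f (Set.Icc (I i) (I (i + 1))) ≠ ⊤ :=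
    ne_top_of_le_ne_top ENNReal.ofReal_ne_top ((eVariationOn.mono f (hsubIcc hi)).trans hf)
  have hint' (i : ℕ) (hi : i < K) : IntervalIntegrable f volume (I i) (I (i + 1)) := by
    refine hint.mono_set ?_
    rw [Set.uIcc_of_le (hmono (Nat.le_succ i)), Set.uIcc_of_le zero_le_one]
    exact hsubIcc hi
  have hadj := intervalIntegral.sum_integral_adjacent_intervals hint'
  rw [hI0, hIK] at hadj
  have hcell (i : ℕ) (hi : i < K) :
      |f (midpointNode K i) - K * ∫ x in I i..I (i + 1), f x| ≤
        (eVariationOn f (Set.Icc (I i) (I (i + 1)))).toReal := by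
    have hxi : midpointNode K i ∈ Set.Icc (I i) (I (i + 1)) := by
      rw [midpointNode_eq hK]
      simp only [hI]
      constructor
      · gcongr; linarith
      · push_cast; gcongr; norm_num
    have hb := intervalIntegral.norm_integral_le_of_norm_le_const (a := I i) (b := I (i + 1))
      (f := fun x => f (midpointNode K i) - f x)
      (C := (eVariationOn f (Set.Icc (I i) (I (i + 1)))).toReal) (by
        intro x hx
        rw [Set.uIoc_of_le (hmono (Nat.le_succ i))] at hx
        rw [← dist_eq_norm, dist_edist]
        exact ENNReal.toReal_mono (hfin hi)
          (eVariationOn.edist_le f hxi (Set.Ioc_subset_Icc_self hx)))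
    rw [intervalIntegral.integral_sub intervalIntegrable_const (hint' i hi),
      intervalIntegral.integral_const, hlen, smul_eq_mul, abs_of_pos (by positivity),
      Real.norm_eq_abs] at hb
    have hrw : f (midpointNode K i) - K * ∫ x in I i..I (i + 1), f x =
        K * (1 / K * f (midpointNode K i) - ∫ x in I i..I (i + 1), f x) := by
      field_simp
    rw [hrw, abs_mul, abs_of_pos hK0]
    calc _ ≤ K * ((eVariationOn f (Set.Icc (I i) (I (i + 1)))).toReal * (1 / K)) := by gcongr
      _ = _ := by field_simp
  rw [← hadj, Finset.mul_sum, ← Finset.sum_sub_distrib]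
  calc _ ≤ ∑ i ∈ Finset.range K, |f (midpointNode K i) - K * ∫ x in I i..I (i + 1), f x| :=
        Finset.abs_sum_le_sum_abs _ _
    _ ≤ ∑ i ∈ Finset.range K, (eVariationOn f (Set.Icc (I i) (I (i + 1)))).toReal :=
        Finset.sum_le_sum fun i hi => hcell i (Finset.mem_range.1 hi)
    _ = (eVariationOn f (Set.Icc 0 1)).toReal := by
        rw [← hsum, ENNReal.toReal_sum fun i hi => hfin (Finset.mem_range.1 hi)]
    _ ≤ V := ENNReal.toReal_le_of_le_ofReal hV hf

/-! ### Variation of monotone functions of a sinusoid. -/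

theorem eVariationOn_le_one_of_monotoneOn_or_antitoneOn {f : ℝ → ℝ} {a b : ℝ} (hab : a ≤ b)
    (hf : MonotoneOn f (Set.Icc a b) ∨ AntitoneOn f (Set.Icc a b))
    (hf01 : ∀ x, f x ∈ Set.Icc (0 : ℝ) 1) : eVariationOn f (Set.Icc a b) ≤ 1 := by
  have key (g : ℝ → ℝ) (hg : MonotoneOn g (Set.Icc a b)) (h : g b - g a ≤ 1) :
      eVariationOn g (Set.Icc a b) ≤ 1 := by
    have := hg.eVariationOn_eq (Set.left_mem_Icc.2 hab) (Set.right_mem_Icc.2 hab)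
    rw [Set.inter_self] at this
    rw [this, ← ENNReal.ofReal_one]
    exact ENNReal.ofReal_le_ofReal h
  rcases hf with hf | hf
  · exact key f hf (by linarith [(hf01 b).2, (hf01 a).1])
  · have h : eVariationOn (fun x => -f x) (Set.Icc a b) = eVariationOn f (Set.Icc a b) := by
      simp only [eVariationOn, edist_neg_neg]
    rw [← h]
    exact key _ hf.neg (by linarith [(hf01 a).2, (hf01 b).1])

theorem Monotone.comp_monotoneOn_or_antitoneOn_const_mul {M g : ℝ → ℝ} (hM : Monotone M) (r : ℝ)
    {s : Set ℝ} (hg : MonotoneOn g s ∨ AntitoneOn g s) :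
    MonotoneOn (fun x => M (r * g x)) s ∨ AntitoneOn (fun x => M (r * g x)) s := by
  rcases le_total 0 r with hr | hr <;> rcases hg with hg | hg
  · exact .inl fun x hx y hy h => hM (mul_le_mul_of_nonneg_left (hg hx hy h) hr)
  · exact .inr fun x hx y hy h => hM (mul_le_mul_of_nonneg_left (hg hx hy h) hr)
  · exact .inr fun x hx y hy h => hM (mul_le_mul_of_nonpos_left (hg hx hy h) hr)
  · exact .inl fun x hx y hy h => hM (mul_le_mul_of_nonpos_left (hg hx hy h) hr)

/-- The cosine is monotone on each of `[0, p]`, `[p, p + 1/2]`, `[p + 1/2, 1]`, and each piece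
contributes at most 1. A negative `r` merely reverses directions. -/
theorem eVariationOn_comp_cos_le {M : ℝ → ℝ} (hM : Monotone M)
    (hM01 : ∀ a, M a ∈ Set.Icc (0 : ℝ) 1) (r : ℝ) {p : ℝ} (hp : p ∈ Set.Icc (0 : ℝ) (1 / 2)) :
    eVariationOn (fun x => M (r * Real.cos (2 * Real.pi * (x - p)))) (Set.Icc 0 1) ≤
      ENNReal.ofReal 3 := by
  have hpi := Real.pi_pos
  obtain ⟨hp0, hp1⟩ := hp
  set f : ℝ → ℝ := fun x => M (r * Real.cos (2 * Real.pi * (x - p)))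
  have h1 : MonotoneOn (fun x => Real.cos (2 * Real.pi * (x - p))) (Set.Icc 0 p) := by
    intro x hx y hy hxy
    have := Real.cos_le_cos_of_nonneg_of_le_pi (x := 2 * Real.pi * (p - y))
      (y := 2 * Real.pi * (p - x)) (by nlinarith [hy.2]) (by nlinarith [hx.1]) (by nlinarith)
    rw [← Real.cos_neg (2 * Real.pi * (p - y)), ← Real.cos_neg (2 * Real.pi * (p - x))] at this
    change Real.cos _ ≤ Real.cos _
    convert this using 2 <;> ring
  have h2 : AntitoneOn (fun x => Real.cos (2 * Real.pi * (x - p))) (Set.Icc p (p + 1 / 2)) := by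
    intro x hx y hy hxy
    exact Real.cos_le_cos_of_nonneg_of_le_pi (by nlinarith [hx.1]) (by nlinarith [hy.2])
      (by nlinarith)
  have h3 : MonotoneOn (fun x => Real.cos (2 * Real.pi * (x - p))) (Set.Icc (p + 1 / 2) 1) := by
    intro x hx y hy hxy
    -- Reflecting and shifting by one period brings the angles into `[0, π]`.
    have := Real.cos_le_cos_of_nonneg_of_le_pi (x := 2 * Real.pi * (p - y + 1))
      (y := 2 * Real.pi * (p - x + 1)) (by nlinarith [hy.2]) (by nlinarith [hx.1]) (by nlinarith)
    rw [← Real.cos_neg (2 * Real.pi * (p - y + 1)), ← Real.cos_neg (2 * Real.pi * (p - x + 1)),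
      ← Real.cos_add_two_pi, ← Real.cos_add_two_pi (-(2 * Real.pi * (p - y + 1)))] at this
    change Real.cos _ ≤ Real.cos _
    convert this using 2 <;> ring
  have e := eVariationOn.Icc_add_Icc f (s := Set.univ) (a := 0) (b := p) (c := p + 1 / 2) hp0
    (by linarith) trivial
  have e' := eVariationOn.Icc_add_Icc f (s := Set.univ) (a := 0) (b := p + 1 / 2) (c := 1)
    (by linarith) (by linarith) trivial
  simp only [Set.univ_inter] at e e'
  rw [← e', ← e, show ENNReal.ofReal 3 = 1 + 1 + 1 by norm_num]
  have hf01 (x : ℝ) : f x ∈ Set.Icc (0 : ℝ) 1 := hM01 _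
  refine add_le_add (add_le_add ?_ ?_) ?_
  · exact eVariationOn_le_one_of_monotoneOn_or_antitoneOn hp0
      (hM.comp_monotoneOn_or_antitoneOn_const_mul r (.inl h1)) hf01
  · exact eVariationOn_le_one_of_monotoneOn_or_antitoneOn (by linarith)
      (hM.comp_monotoneOn_or_antitoneOn_const_mul r (.inr h2)) hf01
  · exact eVariationOn_le_one_of_monotoneOn_or_antitoneOn (by linarith)
      (hM.comp_monotoneOn_or_antitoneOn_const_mul r (.inl h3)) hf01

/-- Polar form of `u + iv`. If the argument is negative, adding `π` and flipping the sign of `r`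
keeps the phase in `[0, 1/2]`, which is what limits the monotone pieces to three. -/
theorem exists_cos_add_sin_eq_mul_cos (u v : ℝ) : ∃ r, ∃ p ∈ Set.Icc (0 : ℝ) (1 / 2), ∀ x : ℝ,
    u * Real.cos (2 * Real.pi * x) + v * Real.sin (2 * Real.pi * x) =
      r * Real.cos (2 * Real.pi * (x - p)) := by
  have hpi := Real.pi_pos
  set z : ℂ := ⟨u, v⟩
  have hu : u = ‖z‖ * Real.cos z.arg := (Complex.norm_mul_cos_arg z).symm
  have hv : v = ‖z‖ * Real.sin z.arg := (Complex.norm_mul_sin_arg z).symm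
  rcases le_or_gt 0 z.arg with h | h
  · refine ⟨‖z‖, z.arg / (2 * Real.pi), ⟨by positivity, ?_⟩, fun x => ?_⟩
    · rw [div_le_iff₀ (by positivity)]
      linarith [Complex.arg_le_pi z]
    · rw [show 2 * Real.pi * (x - z.arg / (2 * Real.pi)) = 2 * Real.pi * x - z.arg by field_simp,
        Real.cos_sub]
      conv_lhs => rw [hu, hv]
      ring
  · refine ⟨-‖z‖, (z.arg + Real.pi) / (2 * Real.pi), ⟨?_, ?_⟩, fun x => ?_⟩
    · exact div_nonneg (by linarith [Complex.neg_pi_lt_arg z]) (by positivity)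
    · rw [div_le_iff₀ (by positivity)]
      linarith
    · rw [show 2 * Real.pi * (x - (z.arg + Real.pi) / (2 * Real.pi)) =
        2 * Real.pi * x - z.arg - Real.pi by field_simp; ring, Real.cos_sub_pi, Real.cos_sub]
      conv_lhs => rw [hu, hv]
      ring

/-! ### Meridian sections of caps. -/

/-- The heights `y ∈ (0, 1)` at which a meridian meets the cap `C(w, t)`, where `a` is the
horizontal component of `w` along the meridian and `c` its vertical component. -/
def meridianSection (a c t : ℝ) : Set ℝ :=
  {y | y ∈ Set.Ioo (0 : ℝ) 1 ∧ t ≤ a * (2 * √(y - y ^ 2)) + c * (1 - 2 * y)}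

theorem meridianSection_subset (a c t : ℝ) : meridianSection a c t ⊆ Set.Ioo 0 1 := fun _ h => h.1

theorem measurableSet_meridianSection (a c t : ℝ) : MeasurableSet (meridianSection a c t) := by
  unfold meridianSection
  have h : MeasurableSet {y : ℝ | t ≤ a * (2 * √(y - y ^ 2)) + c * (1 - 2 * y)} :=
    measurableSet_le (by fun_prop) (by fun_prop)
  exact measurableSet_Ioo.inter h

theorem meridianSection_mono {a a' : ℝ} (h : a ≤ a') (c t : ℝ) :
    meridianSection a c t ⊆ meridianSection a' c t := fun y hy =>
  ⟨hy.1, hy.2.trans (by gcongr)⟩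

theorem concaveOn_two_mul_sqrt_sub_sq :
    ConcaveOn ℝ (Set.Ioo (0 : ℝ) 1) fun y => 2 * √(y - y ^ 2) := by
  refine ⟨convex_Ioo 0 1, fun x hx y hy a b ha hb hab => ?_⟩
  have hu := Real.sq_sqrt (by nlinarith [hx.1, hx.2] : 0 ≤ x - x ^ 2)
  have hv := Real.sq_sqrt (by nlinarith [hy.1, hy.2] : 0 ≤ y - y ^ 2)
  set u := √(x - x ^ 2)
  set v := √(y - y ^ 2)
  simp only [smul_eq_mul]
  suffices a * u + b * v ≤ √(a * x + b * y - (a * x + b * y) ^ 2) by linarith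
  apply Real.le_sqrt_of_sq_le
  have hb' : b = 1 - a := by linarith
  -- The two variance terms enter the squares with opposite signs, both in favour of the inequality.
  have h1 : 0 ≤ a * b * (u - v) ^ 2 := by positivity
  have h2 : 0 ≤ a * b * (x - y) ^ 2 := by positivity
  have h3 : (a * u + b * v) ^ 2 = a * u ^ 2 + b * v ^ 2 - a * b * (u - v) ^ 2 := by
    rw [hb']; ring
  have h4 : a * x + b * y - (a * x + b * y) ^ 2 =
      a * (x - x ^ 2) + b * (y - y ^ 2) + a * b * (x - y) ^ 2 := by
    rw [hb']; ring
  rw [h3, h4, hu, hv]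
  linarith

theorem concaveOn_meridian {a : ℝ} (ha : 0 ≤ a) (c : ℝ) :
    ConcaveOn ℝ (Set.Ioo (0 : ℝ) 1) fun y => a * (2 * √(y - y ^ 2)) + c * (1 - 2 * y) := by
  have h : ConcaveOn ℝ (Set.Ioo (0 : ℝ) 1) fun y => c * (1 - 2 * y) := by
    refine ⟨convex_Ioo 0 1, fun x _ y _ p q _ _ hpq => le_of_eq ?_⟩
    simp only [smul_eq_mul]
    linear_combination c * hpq
  exact (concaveOn_two_mul_sqrt_sub_sq.smul ha).add h

theorem ordConnected_meridianSection {a : ℝ} (ha : 0 ≤ a) (c t : ℝ) :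
    (meridianSection a c t).OrdConnected :=
  ((concaveOn_meridian ha c).convex_ge t).ordConnected

/-- After a sign change the complement is a strict superlevel set of a concave function. -/
theorem ordConnected_diff_meridianSection {a : ℝ} (ha : a ≤ 0) (c t : ℝ) :
    (Set.Ioo 0 1 \ meridianSection a c t).OrdConnected := by
  have h := ((concaveOn_meridian (neg_nonneg.2 ha) (-c)).convex_gt (-t)).ordConnected
  have e : Set.Ioo 0 1 \ meridianSection a c t =
      {y ∈ Set.Ioo (0 : ℝ) 1 | -t < -a * (2 * √(y - y ^ 2)) + -c * (1 - 2 * y)} := by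
    ext y
    simp only [meridianSection, Set.mem_sdiff, Set.mem_ofPred_eq, not_and, not_le]
    refine and_congr_right fun hy => ⟨fun hh => ?_, fun hh _ => ?_⟩
    · linarith [hh hy]
    · linarith
  rw [e]
  exact h

open Classical in
theorem abs_card_meridianSection_sub_le {K : ℕ} (hK : 1 ≤ K) (a c t : ℝ) :
    |(((Finset.range K).filter fun j => midpointNode K j ∈ meridianSection a c t).card : ℝ) -
      K * volume.real (meridianSection a c t)| ≤ 1 := by
  rcases le_total 0 a with ha | ha
  · exact abs_card_midpointNode_sub_le_of_ordConnected hK (ordConnected_meridianSection ha c t)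
      (meridianSection_subset a c t)
  · exact abs_card_midpointNode_sub_le_of_ordConnected_diff hK
      (ordConnected_diff_meridianSection ha c t) (meridianSection_subset a c t)
      (measurableSet_meridianSection a c t)

theorem monotone_volume_meridianSection (c t : ℝ) :
    Monotone fun a => volume.real (meridianSection a c t) := fun a a' h =>
  measureReal_mono (meridianSection_mono h c t)
    (ne_top_of_le_ne_top (by simp) (measure_mono (meridianSection_subset a' c t)))

theorem volume_meridianSection_mem (a c t : ℝ) :
    volume.real (meridianSection a c t) ∈ Set.Icc (0 : ℝ) 1 := by
  refine ⟨measureReal_nonneg, ?_⟩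
  have h := measureReal_mono (μ := volume) (meridianSection_subset a c t) (by simp)
  simpa using h

/-! ### Cap areas as integrals of section lengths. -/

theorem measurableSet_sphericalCap (w : S2) (t : ℝ) : MeasurableSet (sphericalCap w t) := by
  unfold sphericalCap
  exact measurableSet_le measurable_const
    ((continuous_const.inner continuous_subtype_val).measurable)

theorem inner_lambertVec (w : E3) (x y : ℝ) : inner ℝ w (lambertVec x y) =
    (w 0 * Real.cos (2 * Real.pi * x) + w 1 * Real.sin (2 * Real.pi * x)) *
      (2 * √(y - y ^ 2)) + w 2 * (1 - 2 * y) := by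
  simp [lambertVec, PiLp.inner_apply, Fin.sum_univ_three]
  ring

/-- The horizontal component of `w` along the meridian with parameter `x`. -/
noncomputable def meridianComponent (w : S2) (x : ℝ) : ℝ :=
  (w : E3) 0 * Real.cos (2 * Real.pi * x) + (w : E3) 1 * Real.sin (2 * Real.pi * x)

theorem mem_lambertPreimage_sphericalCap {w : S2} {t : ℝ} {p : ℝ × ℝ} :
    p ∈ lambertPreimage (sphericalCap w t) ↔ p.1 ∈ Set.Ico (0 : ℝ) 1 ∧
      p.2 ∈ meridianSection (meridianComponent w p.1) ((w : E3) 2) t := by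
  constructor
  · rintro ⟨q, hq, rfl⟩
    refine ⟨q.2.1, q.2.2, ?_⟩
    have : t ≤ inner ℝ (w : E3) (lambertVec q.1.1 q.1.2) := hq
    rwa [inner_lambertVec] at this
  · rintro ⟨h1, h2, h3⟩
    refine ⟨⟨p, h1, h2⟩, ?_, rfl⟩
    change t ≤ inner ℝ (w : E3) (lambertVec p.1 p.2)
    rwa [inner_lambertVec]

theorem measurable_volume_meridianSection (w : S2) (t : ℝ) :
    Measurable fun x => volume (meridianSection (meridianComponent w x) ((w : E3) 2) t) := by
  have hB : MeasurableSet {p : ℝ × ℝ |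
      p.2 ∈ meridianSection (meridianComponent w p.1) ((w : E3) 2) t} := by
    have h : MeasurableSet {p : ℝ × ℝ | t ≤ meridianComponent w p.1 * (2 * √(p.2 - p.2 ^ 2)) +
        (w : E3) 2 * (1 - 2 * p.2)} := by
      unfold meridianComponent
      exact measurableSet_le (by fun_prop) (by fun_prop)
    exact (measurable_snd measurableSet_Ioo).inter h
  exact measurable_measure_prodMk_left hB

theorem sphereMeasure_real_sphericalCap (w : S2) (t : ℝ) :
    sphereMeasure.real (sphericalCap w t) =
      ∫ x in (0 : ℝ)..1, volume.real (meridianSection (meridianComponent w x) ((w : E3) 2) t) := by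
  rw [Measure.real, sphereMeasure_apply (measurableSet_sphericalCap w t), Measure.volume_eq_prod,
    Measure.prod_apply (measurableSet_lambertPreimage (measurableSet_sphericalCap w t)),
    intervalIntegral.integral_of_le zero_le_one, integral_Ioc_eq_integral_Ioo,
    ← integral_Ico_eq_integral_Ioo]
  have hind : (fun x => volume (Prod.mk x ⁻¹' lambertPreimage (sphericalCap w t))) =
      (Set.Ico (0 : ℝ) 1).indicator
        fun x => volume (meridianSection (meridianComponent w x) ((w : E3) 2) t) := by
    funext x
    by_cases hx : x ∈ Set.Ico (0 : ℝ) 1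
    · rw [Set.indicator_of_mem hx]
      congr 1
      ext y
      simp only [Set.mem_preimage, mem_lambertPreimage_sphericalCap, hx, true_and]
    · rw [Set.indicator_of_notMem hx]
      convert measure_empty (μ := volume)
      ext y
      simp only [Set.mem_preimage, mem_lambertPreimage_sphericalCap, hx, false_and,
        Set.mem_empty_iff_false]
  rw [hind, lintegral_indicator measurableSet_Ico]
  refine (integral_toReal (measurable_volume_meridianSection w t).aemeasurable ?_).symm
  exact ae_of_all _ fun x => lt_of_le_of_lt (measure_mono (meridianSection_subset _ _ t)) (by simp)

/-! ### Lattice points and their count in caps. -/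

/-- The lattice points of the unit square, indexed by pairs of natural numbers. -/
noncomputable def gridPoint (K : ℕ) (ij : ℕ × ℕ) : ℝ × ℝ :=
  (midpointNode K ij.1, midpointNode K ij.2)

theorem gridPoint_injective {K : ℕ} (hK : 1 ≤ K) : Function.Injective (gridPoint K) := by
  have hK0 : (K : ℝ) ≠ 0 := by positivity
  have h (i j : ℕ) (hij : midpointNode K i = midpointNode K j) : i = j := by
    simp only [midpointNode, add_left_inj] at hij
    exact_mod_cast (div_left_inj' hK0).1 hij
  intro p q hpq
  exact Prod.ext (h _ _ (congrArg Prod.fst hpq)) (h _ _ (congrArg Prod.snd hpq))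

theorem exists_eq_midpointNode {K : ℕ} (hK : 1 ≤ K) {a : ℤ}
    (ha : (a : ℝ) / K + 1 / (2 * K) ∈ Set.Ico (0 : ℝ) 1) :
    ∃ i < K, midpointNode K i = (a : ℝ) / K + 1 / (2 * K) := by
  have hK0 : (0 : ℝ) < K := by exact_mod_cast hK
  have e : (a : ℝ) / K + 1 / (2 * K) = (a + 1 / 2) / K := by field_simp
  rw [e] at ha
  have h1 := (le_div_iff₀ hK0).1 ha.1
  have h2 := (div_lt_one hK0).1 ha.2
  have h1' : (-1 : ℝ) < a := by linarith
  have h2' : (a : ℝ) < K := by linarith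
  have h3 : -1 < a := by exact_mod_cast h1'
  have h4 : a < K := by exact_mod_cast h2'
  obtain ⟨i, rfl⟩ := Int.eq_ofNat_of_zero_le (by omega : 0 ≤ a)
  exact ⟨i, by omega, by simp [midpointNode]⟩

theorem standardPoints_eq {K : ℕ} (hK : 1 ≤ K) :
    standardPoints K = gridPoint K '' ↑(Finset.range K ×ˢ Finset.range K) := by
  ext p
  constructor
  · rintro ⟨⟨a, b, rfl⟩, h⟩
    obtain ⟨i, hi, hi'⟩ := exists_eq_midpointNode hK h.1
    obtain ⟨j, hj, hj'⟩ := exists_eq_midpointNode hK (Set.Ioo_subset_Ico_self h.2)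
    exact ⟨(i, j), by simp [hi, hj], Prod.ext hi' hj'⟩
  · rintro ⟨⟨i, j⟩, hij, rfl⟩
    simp only [Finset.coe_product, Finset.coe_range, Set.mem_prod, Set.mem_Iio] at hij
    exact ⟨⟨i, j, by simp [gridPoint, midpointNode]⟩,
      Set.Ioo_subset_Ico_self (midpointNode_mem hij.1), midpointNode_mem hij.2⟩

theorem ncard_standardPoints {K : ℕ} (hK : 1 ≤ K) : (standardPoints K).ncard = K ^ 2 := by
  rw [standardPoints_eq hK, Set.ncard_image_of_injective _ (gridPoint_injective hK),
    Set.ncard_coe_finset, Finset.card_product, Finset.card_range, sq]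

theorem ncard_lambertImage_inter (P : Set (ℝ × ℝ)) (A : Set S2) :
    (lambertImage P ∩ A).ncard = (P ∩ lambertPreimage A).ncard := by
  have h1 : lambertImage P ∩ A = lambert '' (Subtype.val ⁻¹' P ∩ lambert ⁻¹' A) := by
    ext q
    constructor
    · rintro ⟨⟨p, hp, rfl⟩, hq⟩
      exact ⟨p, ⟨hp, hq⟩, rfl⟩
    · rintro ⟨p, ⟨hp, hq⟩, rfl⟩
      exact ⟨⟨p, hp, rfl⟩, hq⟩
  have h2 : P ∩ lambertPreimage A = Subtype.val '' (Subtype.val ⁻¹' P ∩ lambert ⁻¹' A) := by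
    rw [lambertPreimage, Set.image_preimage_inter]
  rw [h1, h2, Set.ncard_image_of_injective _ lambert_injective,
    Set.ncard_image_of_injective _ Subtype.val_injective]

theorem ncard_lambertImage_standardPoints {K : ℕ} (hK : 1 ≤ K) :
    (lambertImage (standardPoints K)).ncard = K ^ 2 := by
  have h := ncard_lambertImage_inter (standardPoints K) Set.univ
  have hu : lambertPreimage Set.univ = unitSquare := by
    simp [lambertPreimage]
  rw [Set.inter_univ, hu, Set.inter_eq_left.2 (fun p hp => hp.2 : standardPoints K ⊆ unitSquare),
    ncard_standardPoints hK] at h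
  exact h

open Classical in
theorem ncard_lambertImage_inter_sphericalCap {K : ℕ} (hK : 1 ≤ K) (w : S2) (t : ℝ) :
    (lambertImage (standardPoints K) ∩ sphericalCap w t).ncard =
      ∑ i ∈ Finset.range K, ((Finset.range K).filter fun j => midpointNode K j ∈
        meridianSection (meridianComponent w (midpointNode K i)) ((w : E3) 2) t).card := by
  rw [ncard_lambertImage_inter, standardPoints_eq hK, ← Set.image_inter_preimage,
    Set.ncard_image_of_injective _ (gridPoint_injective hK)]
  have : (↑(Finset.range K ×ˢ Finset.range K) ∩
      gridPoint K ⁻¹' lambertPreimage (sphericalCap w t) : Set (ℕ × ℕ)) =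
      ↑((Finset.range K ×ˢ Finset.range K).filter fun ij : ℕ × ℕ => midpointNode K ij.2 ∈
        meridianSection (meridianComponent w (midpointNode K ij.1)) ((w : E3) 2) t) := by
    ext ⟨i, j⟩
    simp only [Set.mem_inter_iff, Set.mem_preimage, mem_lambertPreimage_sphericalCap, gridPoint,
      Finset.coe_filter, Set.mem_ofPred_eq, Finset.mem_coe]
    refine and_congr_right fun hij => and_iff_right ?_
    exact Set.Ioo_subset_Ico_self
      (midpointNode_mem (Finset.mem_range.1 (Finset.mem_product.1 hij).1))
  rw [this, Set.ncard_coe_finset, Finset.card_filter, Finset.sum_product]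
  simp only [Finset.card_filter]

/-! ### The upper bound for a single cap. -/

theorem capDiscrepancyAt_le {K : ℕ} (hK : 1 ≤ K) (w : S2) (t : ℝ) :
    capDiscrepancyAt (lambertImage (standardPoints K)) w t ≤ 4 / K := by
  classical
  have hK0 : (0 : ℝ) < K := by exact_mod_cast hK
  obtain ⟨r, p, hp, hrp⟩ := exists_cos_add_sin_eq_mul_cos ((w : E3) 0) ((w : E3) 1)
  have hvar := eVariationOn_comp_cos_le (monotone_volume_meridianSection ((w : E3) 2) t)
    (fun a => volume_meridianSection_mem a _ t) r hp
  simp only [← hrp] at hvar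
  change eVariationOn (fun x => volume.real
    (meridianSection (meridianComponent w x) ((w : E3) 2) t)) _ ≤ _ at hvar
  have hint : IntervalIntegrable (fun x => volume.real
      (meridianSection (meridianComponent w x) ((w : E3) 2) t)) volume 0 1 := by
    refine (intervalIntegrable_const (c := (1 : ℝ))).mono_fun
      (measurable_volume_meridianSection w t).ennreal_toReal.aestronglyMeasurable
      (ae_of_all _ fun x => ?_)
    have h := volume_meridianSection_mem (meridianComponent w x) ((w : E3) 2) t
    simp only [Real.norm_of_nonneg h.1, norm_one]
    exact h.2
  have hsum := abs_sum_midpointNode_sub_integral_le hK (by norm_num) hvar hint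
  rw [← sphereMeasure_real_sphericalCap] at hsum
  have hcount : |((lambertImage (standardPoints K) ∩ sphericalCap w t).ncard : ℝ) -
      K * ∑ i ∈ Finset.range K, volume.real
        (meridianSection (meridianComponent w (midpointNode K i)) ((w : E3) 2) t)| ≤ K := by
    rw [ncard_lambertImage_inter_sphericalCap hK, Nat.cast_sum, Finset.mul_sum,
      ← Finset.sum_sub_distrib]
    refine (Finset.abs_sum_le_sum_abs _ _).trans ((Finset.sum_le_sum fun i _ =>
      abs_card_meridianSection_sub_le hK _ _ t).trans ?_)
    simp
  rw [capDiscrepancyAt, ncard_lambertImage_standardPoints hK]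
  set n : ℝ := ((lambertImage (standardPoints K) ∩ sphericalCap w t).ncard : ℝ)
  set σ := sphereMeasure.real (sphericalCap w t)
  set S := ∑ i ∈ Finset.range K, volume.real
        (meridianSection (meridianComponent w (midpointNode K i)) ((w : E3) 2) t)
  -- Splits the error into the counting errors within columns and the quadrature error across
  -- columns.
  have e : n / ((K ^ 2 : ℕ) : ℝ) - σ = ((n - K * S) + K * (S - K * σ)) / K ^ 2 := by
    push_cast
    field_simp
    ring
  rw [e, abs_div, abs_of_pos (by positivity : (0 : ℝ) < K ^ 2),
    div_le_div_iff₀ (by positivity) hK0]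
  have h3 : |n - K * S + K * (S - K * σ)| ≤ K + K * 3 := by
    refine (abs_add_le _ _).trans (add_le_add hcount ?_)
    rw [abs_mul, abs_of_pos hK0]
    gcongr
  nlinarith

/-! ### Polar caps, suprema and the conclusion. -/

theorem meridianComponent_northPole (x : ℝ) : meridianComponent northPole x = 0 := by
  simp [meridianComponent, northPole]

theorem northPole_apply_two : (northPole : E3) 2 = 1 := by simp [northPole]

theorem capDiscrepancyAt_northPole {K : ℕ} (hK : 1 ≤ K) {t : ℝ}
    (ht : t ∈ Set.Ioo ((2 * (K : ℝ) - 1) / (2 * K)) 1) :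
    capDiscrepancyAt (lambertImage (standardPoints K)) northPole t = (1 - t) / 2 := by
  classical
  have hK0 : (0 : ℝ) < K := by exact_mod_cast hK
  have hK1 : (1 : ℝ) ≤ K := by exact_mod_cast hK
  have ht' := (div_lt_iff₀ (by positivity)).1 ht.1
  have ht0 : 0 < t := lt_of_le_of_lt (div_nonneg (by linarith) (by positivity)) ht.1
  have hsec (x : ℝ) : meridianSection (meridianComponent northPole x) ((northPole : E3) 2) t =
      Set.Ioc 0 ((1 - t) / 2) := by
    rw [meridianComponent_northPole, northPole_apply_two]
    ext y
    simp only [meridianSection, Set.mem_ofPred_eq, Set.mem_Ioo, Set.mem_Ioc]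
    constructor
    · rintro ⟨⟨h1, h2⟩, h3⟩
      exact ⟨h1, by linarith⟩
    · rintro ⟨h1, h2⟩
      exact ⟨⟨h1, by linarith⟩, by linarith⟩
  have hσ : sphereMeasure.real (sphericalCap northPole t) = (1 - t) / 2 := by
    rw [sphereMeasure_real_sphericalCap]
    simp only [hsec, Real.volume_real_Ioc_of_le (by linarith [ht.2] : 0 ≤ (1 - t) / 2)]
    simp
  have hn : (lambertImage (standardPoints K) ∩ sphericalCap northPole t).ncard = 0 := by
    rw [ncard_lambertImage_inter_sphericalCap hK]
    refine Finset.sum_eq_zero fun i _ => Finset.card_eq_zero.2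
      (Finset.filter_eq_empty_iff.2 fun j _ hj => ?_)
    -- Membership would give `j + 1/2 ≤ K * (1 - t) / 2 < 1/4`. The threshold on `t` is thus not the
    -- height of the top row, which lies lower, at `1 - 1 / K`.
    rw [hsec, midpointNode_eq hK] at hj
    have h := (div_le_iff₀ hK0).1 hj.2
    have hj0 : (0 : ℝ) ≤ j := Nat.cast_nonneg j
    linarith
  rw [capDiscrepancyAt, hn, hσ, Nat.cast_zero, zero_div, zero_sub, abs_neg,
    abs_of_nonneg (by linarith [ht.2])]

theorem div_two_mul_lt_one {K : ℕ} (hK : 1 ≤ K) : (2 * (K : ℝ) - 1) / (2 * K) < 1 := by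
  have hK0 : (0 : ℝ) < K := by exact_mod_cast hK
  rw [div_lt_one (by positivity)]
  linarith

theorem tendsto_capDiscrepancyAt_northPole {K : ℕ} (hK : 1 ≤ K) :
    Tendsto (fun t : ℝ => (K : ℝ) *
        capDiscrepancyAt (lambertImage (standardPoints K)) northPole t)
      (𝓝[>] ((2 * (K : ℝ) - 1) / (2 * K))) (𝓝 (1 / 4)) := by
  have hK0 : (K : ℝ) ≠ 0 := by positivity
  have hc : Tendsto (fun t : ℝ => (K : ℝ) * ((1 - t) / 2))
      (𝓝[>] ((2 * (K : ℝ) - 1) / (2 * K))) (𝓝 (1 / 4)) := by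
    have h : Continuous fun t : ℝ => (K : ℝ) * ((1 - t) / 2) := by fun_prop
    have := (h.tendsto ((2 * (K : ℝ) - 1) / (2 * K))).mono_left
      (nhdsWithin_le_nhds (s := Set.Ioi ((2 * (K : ℝ) - 1) / (2 * K))))
    convert this using 2
    field_simp
    ring
  refine hc.congr' ?_
  filter_upwards [Ioo_mem_nhdsGT (div_two_mul_lt_one hK)] with t ht
  rw [capDiscrepancyAt_northPole hK ht]

/-- Real suprema dominate their terms only for bounded families; the uniform bound `4 / K` supplies
the boundedness of both. -/
theorem capDiscrepancyAt_le_capDiscrepancy {K : ℕ} (hK : 1 ≤ K) (w : S2) {t : ℝ}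
    (ht : t ∈ Set.Icc (-1 : ℝ) 1) :
    capDiscrepancyAt (lambertImage (standardPoints K)) w t ≤
      capDiscrepancy (lambertImage (standardPoints K)) := by
  have hb (w : S2) : (⨆ t : Set.Icc (-1 : ℝ) 1,
      capDiscrepancyAt (lambertImage (standardPoints K)) w t) ≤ 4 / K :=
    Real.iSup_le (fun t => capDiscrepancyAt_le hK w t) (by positivity)
  have h1 := le_ciSup (f := fun t : Set.Icc (-1 : ℝ) 1 =>
    capDiscrepancyAt (lambertImage (standardPoints K)) w t)
    ⟨4 / K, by rintro _ ⟨t, rfl⟩; exact capDiscrepancyAt_le hK w t⟩ ⟨t, ht⟩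
  exact h1.trans (le_ciSup (f := fun w : S2 => ⨆ t : Set.Icc (-1 : ℝ) 1,
    capDiscrepancyAt (lambertImage (standardPoints K)) w t)
    ⟨4 / K, by rintro _ ⟨w, rfl⟩; exact hb w⟩ w)

theorem capDiscrepancy_le {K : ℕ} (hK : 1 ≤ K) :
    capDiscrepancy (lambertImage (standardPoints K)) ≤ 4 / K :=
  Real.iSup_le (fun w => Real.iSup_le (fun t => capDiscrepancyAt_le hK w t) (by positivity))
    (by positivity)

theorem mainTheorem3 (K : ℕ) (hK : 1 ≤ K) :
    (standardPoints K).ncard = K ^ 2 ∧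
    (lambertImage (standardPoints K)).ncard = K ^ 2 ∧
    1 / 4 ≤ √((standardPoints K).ncard : ℝ) *
      capDiscrepancy (lambertImage (standardPoints K)) ∧
    √((standardPoints K).ncard : ℝ) *
      capDiscrepancy (lambertImage (standardPoints K)) ≤ √18 ∧
    Tendsto
      (fun t : ℝ => √((standardPoints K).ncard : ℝ) *
        capDiscrepancyAt (lambertImage (standardPoints K)) northPole t)
      (𝓝[>] ((2 * (K : ℝ) - 1) / (2 * K))) (𝓝 (1 / 4)) := by
  have hK0 : (0 : ℝ) < K := by exact_mod_cast hK
  have hsqrt : √((standardPoints K).ncard : ℝ) = K := by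
    rw [ncard_standardPoints hK, Nat.cast_pow, Real.sqrt_sq hK0.le]
  have hlim := tendsto_capDiscrepancyAt_northPole hK
  rw [hsqrt]
  refine ⟨ncard_standardPoints hK, ncard_lambertImage_standardPoints hK, ?_, ?_, hlim⟩
  · refine le_of_tendsto hlim ?_
    filter_upwards [Ioo_mem_nhdsGT (div_two_mul_lt_one hK)] with t ht
    have ht0 : 0 ≤ (2 * (K : ℝ) - 1) / (2 * K) :=
      div_nonneg (by linarith [(by exact_mod_cast hK : (1 : ℝ) ≤ K)]) (by positivity)
    gcongr
    exact capDiscrepancyAt_le_capDiscrepancy hK northPole ⟨by linarith [ht.1], ht.2.le⟩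
  · calc (K : ℝ) * capDiscrepancy (lambertImage (standardPoints K)) ≤ K * (4 / K) := by
          gcongr
          exact capDiscrepancy_le hK
      _ = 4 := by field_simp
      _ ≤ √18 := Real.le_sqrt_of_sq_le (by norm_num)
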